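/- Let $G=(V,E)$ run through a sequence of finite simple undirected graphs (or, more generally, through a family indexed by a set with a filter along which all limits are taken) with $n_v=|V|\to\infty$ and $|E|=\Theta(n_v\log n_v)$. Let $V^{(2)}$ be the set of unordered pairs of distinct vertices and $E^c=V^{(2)}\setminus E$. For each graph let $(Y_e)_{e\in V^{(2)}}$ be independent $\{0,1\}$-valued random variables with $\mathbb P(Y_e=1)=\alpha$ for $e\in E^c$ and $\mathbb P(Y_e=1)=1-\beta$ for $e\in E$, where $\alpha,\beta\in(0,1)$ may depend on the graph. Suppose that $\alpha|E^c|=\beta|E|=:\lambda$ and that the error rate is of constant order, $\lambda=\Theta(1)$. Let $\hat E=\{e\in V^{(2)}:Y_e=1\}$, $D_E=|\hat E|-|E|$ and $\sigma^2=\operatorname{Var}(D_E)$. Let $\mathrm{Skellam}(\lambda,\lambda)$ be the law on $\mathbb Z$ with $\mathbb P(W=k)=e^{-2\lambda}I_k(2\lambda)$, where $I_k$ is the modified Bessel function of the first kind, and let $d_{KS}(X_1,X_2)=\sup_{x\in\mathbb R}|\mathbb P(X_1\le x)-\mathbb P(X_2\le x)|$. Then $$d_{KS}\bigl(D_E,\mathrm{Skellam}(\lambda,\lambda)\bigr)=O\bigl((n_v\log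 n_v)^{-1}\bigr),\qquad d_{KS}\bigl(D_E/\sigma,N(0,1)\bigr)=\Omega\bigl((n_v\log n_v)^{-1}\bigr),$$ and eventually (for all sufficiently large $n_v$ in the case of a sequence) the Skellam approximation is at least as good as the normal one: $$d_{KS}\bigl(D_E,\mathrm{Skellam}(\lambda,\lambda)\bigr)\le d_{KS}\bigl(D_E/\sigma,N(0,1)\bigr).$$ -/

import Mathlib

open MeasureTheory ProbabilityTheory Filter Topology Asymptotics
open scoped NNReal ENNReal Nat

namespace EdgeNoise

noncomputable section

/-! ### The Skellam distribution -/

/-- The modified Bessel function of the first kind `I_k(x)` of integer order `k`, given by its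
power series (recall that `I_{-k} = I_k` for integers `k`). -/
def besselI (k : ℤ) (x : ℝ) : ℝ :=
  ∑' m : ℕ, (x / 2) ^ (2 * m + k.natAbs) / ((m ! : ℝ) * ((m + k.natAbs)! : ℝ))

/-- The Skellam probability mass function with parameters `l₁, l₂ > 0`. -/
def skellamPMFReal (l₁ l₂ : ℝ) (k : ℤ) : ℝ :=
  Real.exp (-(l₁ + l₂)) * (√(l₁ / l₂)) ^ k * besselI k (2 * √(l₁ * l₂))

/-- The Skellam distribution with parameters `l₁, l₂ > 0`, as a measure on `ℤ`. -/
def skellam (l₁ l₂ : ℝ) : Measure ℤ :=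
  Measure.sum fun k : ℤ => ENNReal.ofReal (skellamPMFReal l₁ l₂ k) • Measure.dirac k

/-- The Skellam distribution with parameters `l₁, l₂ > 0`, as a measure on `ℝ`. -/
def skellamReal (l₁ l₂ : ℝ) : Measure ℝ := (skellam l₁ l₂).map (fun k : ℤ => (k : ℝ))

lemma summable_besselI (k : ℤ) (x : ℝ) :
    Summable fun m : ℕ =>
      (x / 2) ^ (2 * m + k.natAbs) / ((m ! : ℝ) * ((m + k.natAbs)! : ℝ)) := by
  have h := (Real.summable_pow_div_factorial ((x / 2) ^ 2)).mul_left (|x / 2| ^ k.natAbs)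
  refine Summable.of_norm_bounded h fun m => ?_
  have hm : (0 : ℝ) < (m ! : ℝ) := by positivity
  have h1 : (1 : ℝ) ≤ ((m + k.natAbs)! : ℝ) := by exact_mod_cast Nat.factorial_pos _
  have hd : |(m ! : ℝ) * ((m + k.natAbs)! : ℝ)| = (m ! : ℝ) * ((m + k.natAbs)! : ℝ) :=
    abs_of_nonneg (by positivity)
  rw [norm_div, norm_pow, Real.norm_eq_abs, Real.norm_eq_abs, hd, pow_add, pow_mul, sq_abs,
    ← mul_div_assoc, mul_comm]
  exact div_le_div_of_nonneg_left (by positivity) hm (le_mul_of_one_le_right hm.le h1)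

lemma skellamPMFReal_natCast {l₁ l₂ : ℝ} (h₁ : 0 < l₁) (h₂ : 0 < l₂) (n m : ℕ) :
    Real.exp (-(l₁ + l₂)) * (√(l₁ / l₂)) ^ (n : ℤ) *
      ((2 * √(l₁ * l₂) / 2) ^ (2 * m + n) / ((m ! : ℝ) * ((m + n)! : ℝ))) =
    (Real.exp (-l₁) * l₁ ^ (m + n) / ((m + n)! : ℝ)) * (Real.exp (-l₂) * l₂ ^ m / (m ! : ℝ)) := by
  have e1 : √(l₁ / l₂) * √(l₁ * l₂) = l₁ := by
    rw [← Real.sqrt_mul (by positivity), show l₁ / l₂ * (l₁ * l₂) = l₁ ^ 2 by field_simp,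
      Real.sqrt_sq h₁.le]
  have e2 : √(l₁ * l₂) ^ 2 = l₁ * l₂ := Real.sq_sqrt (by positivity)
  have e3 : (√(l₁ / l₂)) ^ n * (√(l₁ * l₂)) ^ (2 * m + n) = l₁ ^ (m + n) * l₂ ^ m := by
    rw [pow_add, pow_mul, e2]
    calc _ = (√(l₁ / l₂) * √(l₁ * l₂)) ^ n * (l₁ * l₂) ^ m := by rw [mul_pow]; ring
      _ = _ := by rw [e1]; ring
  rw [mul_div_cancel_left₀ _ (two_ne_zero), zpow_natCast, neg_add, Real.exp_add]
  calc _ = Real.exp (-l₁) * Real.exp (-l₂) * ((√(l₁ / l₂)) ^ n * (√(l₁ * l₂)) ^ (2 * m + n)) /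
        ((m ! : ℝ) * ((m + n)! : ℝ)) := by ring
    _ = _ := by rw [e3]; field_simp

lemma skellamPMFReal_neg (l₁ l₂ : ℝ) (k : ℤ) :
    skellamPMFReal l₁ l₂ (-k) = skellamPMFReal l₂ l₁ k := by
  unfold skellamPMFReal besselI
  rw [Int.natAbs_neg, zpow_neg, ← inv_zpow, ← Real.sqrt_inv, inv_div, add_comm l₁ l₂,
    mul_comm l₁ l₂]

/-- The Skellam distribution is the law of the difference of two independent Poisson variables. -/
theorem skellam_eq_map_poisson {l₁ l₂ : ℝ≥0} (h₁ : 0 < l₁) (h₂ : 0 < l₂) :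
    skellam l₁ l₂ =
      ((poissonMeasure l₁).prod (poissonMeasure l₂)).map (fun p : ℕ × ℕ => (p.1 : ℤ) - p.2) := by
  have key : ∀ {a b : ℝ≥0}, 0 < a → 0 < b → ∀ n : ℕ,
      ENNReal.ofReal (skellamPMFReal a b n) =
        ∑' m : ℕ, poissonMeasure a {m + n} * poissonMeasure b {m} := by
    intro a b ha hb n
    have hs := (summable_besselI n (2 * √((a : ℝ) * b))).mul_left
      (Real.exp (-((a : ℝ) + b)) * (√((a : ℝ) / b)) ^ (n : ℤ))
    rw [skellamPMFReal, besselI, ← tsum_mul_left]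
    simp only [Int.natAbs_natCast] at hs ⊢
    rw [ENNReal.ofReal_tsum_of_nonneg (fun m => by positivity) hs]
    refine tsum_congr fun m => ?_
    rw [skellamPMFReal_natCast (by exact_mod_cast ha) (by exact_mod_cast hb),
      poissonMeasure_singleton, poissonMeasure_singleton, ENNReal.ofReal_mul (by positivity)]
  refine Measure.ext_of_singleton fun k => ?_
  rw [skellam, Measure.sum_smul_dirac_singleton,
    Measure.map_apply Measurable.of_discrete (MeasurableSet.of_discrete)]
  obtain ⟨n, rfl | rfl⟩ := k.eq_nat_or_neg
  · rw [Measure.prod_apply_symm MeasurableSet.of_discrete, lintegral_countable', key h₁ h₂]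
    refine tsum_congr fun m => ?_
    congr 2
    ext x
    simp only [Set.mem_singleton_iff, Set.mem_preimage]
    omega
  · rw [Measure.prod_apply MeasurableSet.of_discrete, lintegral_countable', skellamPMFReal_neg,
      key h₂ h₁]
    refine tsum_congr fun m => ?_
    congr 2
    ext x
    simp only [Set.mem_singleton_iff, Set.mem_preimage]
    omega

/-! ### The Kolmogorov-Smirnov distance -/

/-- The Kolmogorov-Smirnov distance of two laws on `ℝ`: the supremum over `x` of the distance
between the distribution functions. -/
def ksDist (μ ν : Measure ℝ) : ℝ :=
  ⨆ x : ℝ, |μ.real (Set.Iic x) - ν.real (Set.Iic x)|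

/-- The family of which the Kolmogorov-Smirnov distance is the supremum is bounded. -/
lemma bddAbove_ksDist (μ ν : Measure ℝ) [IsProbabilityMeasure μ] [IsProbabilityMeasure ν] :
    BddAbove (Set.range fun x : ℝ => |μ.real (Set.Iic x) - ν.real (Set.Iic x)|) := by
  refine ⟨1, ?_⟩
  rintro _ ⟨x, rfl⟩
  have h1 := measureReal_le_one (μ := μ) (s := Set.Iic x)
  have h2 := measureReal_le_one (μ := ν) (s := Set.Iic x)
  have h3 := measureReal_nonneg (μ := μ) (s := Set.Iic x)
  have h4 := measureReal_nonneg (μ := ν) (s := Set.Iic x)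
  exact abs_le.2 ⟨by linarith, by linarith⟩

/-! ### Noisy observation of a graph -/

/-- The set `V⁽²⁾` of unordered pairs of distinct vertices. -/
abbrev VertexPair (V : Type*) : Type _ := {e : Sym2 V // ¬ e.IsDiag}

/-- The inferred edge set `Ê`: the vertex pairs that are declared to be edges. -/
def inferredEdges {V Ω : Type*} (Y : VertexPair V → Ω → Bool) (ω : Ω) : Set (VertexPair V) :=
  {e | Y e ω = true}

/-- The number `|E|` of edges of the true graph. -/
def numEdges {V : Type*} (G : SimpleGraph V) : ℕ := G.edgeSet.ncard

/-- The number `|Eᶜ|` of vertex pairs that are not edges of the true graph. -/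
def numNonEdges {V : Type*} (G : SimpleGraph V) : ℕ :=
  {e : VertexPair V | (e : Sym2 V) ∉ G.edgeSet}.ncard

/-- The discrepancy `D_E = |Ê| - |E|` of the edge counts. -/
def edgeDiscrepancy {V Ω : Type*} (G : SimpleGraph V) (Y : VertexPair V → Ω → Bool) (ω : Ω) : ℝ :=
  ((inferredEdges Y ω).ncard : ℝ) - (numEdges G : ℝ)

/-- `Y` is a family of independent binary decisions, one for each vertex pair, distributed as
Bernoulli(`α`) at the non-edges of `G` and as Bernoulli(`1 - β`) at the edges of `G`. -/
structure IsIndepHomogeneousNoise {V Ω : Type*} [MeasurableSpace Ω] (P : Measure Ω)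
    (G : SimpleGraph V) (Y : VertexPair V → Ω → Bool) (α β : ℝ) : Prop where
  measurable : ∀ e, Measurable (Y e)
  indep : iIndepFun Y P
  prob_nonEdge : ∀ e : VertexPair V, (e : Sym2 V) ∉ G.edgeSet → P.real {ω | Y e ω = true} = α
  prob_edge : ∀ e : VertexPair V, (e : Sym2 V) ∈ G.edgeSet → P.real {ω | Y e ω = true} = 1 - β

/-- The Kolmogorov-Smirnov distance of `D_E` and Skellam(`lam`, `lam`). -/
def ksSkellam {V Ω : Type*} [MeasurableSpace Ω] (P : Measure Ω) (G : SimpleGraph V)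
    (Y : VertexPair V → Ω → Bool) (lam : ℝ) : ℝ :=
  ksDist (P.map (edgeDiscrepancy G Y)) (skellamReal lam lam)

/-- The Kolmogorov-Smirnov distance of `D_E / σ` and the standard normal law, where `σ` is the
standard deviation of `D_E`. -/
def ksNormal {V Ω : Type*} [MeasurableSpace Ω] (P : Measure Ω) (G : SimpleGraph V)
    (Y : VertexPair V → Ω → Bool) : ℝ :=
  ksDist (P.map fun ω => edgeDiscrepancy G Y ω / √(Var[edgeDiscrepancy G Y; P]))
    (gaussianReal 0 1)

end

end EdgeNoise

namespace EdgeNoise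

/-- If two pairs of probability measures are within `δ₁` and `δ₂` in total variation, then their
products are within `δ₁ + δ₂`. -/
lemma prod_apply_le_add {X Y : Type*} [MeasurableSpace X] [MeasurableSpace Y]
    {μ₁ ν₁ : Measure X} {μ₂ ν₂ : Measure Y} [IsProbabilityMeasure μ₁] [IsProbabilityMeasure ν₁]
    [IsProbabilityMeasure μ₂] [IsProbabilityMeasure ν₂] {δ₁ δ₂ : ℝ≥0∞}
    (h₁ : ∀ A, MeasurableSet A → μ₁ A ≤ ν₁ A + δ₁) (h₂ : ∀ A, MeasurableSet A → μ₂ A ≤ ν₂ A + δ₂)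
    {B : Set (X × Y)} (hB : MeasurableSet B) :
    (μ₁.prod μ₂) B ≤ (ν₁.prod ν₂) B + (δ₁ + δ₂) := by
  have step₂ : (μ₁.prod μ₂) B ≤ (μ₁.prod ν₂) B + δ₂ := by
    rw [Measure.prod_apply hB, Measure.prod_apply hB]
    calc _ ≤ ∫⁻ x, (ν₂ (Prod.mk x ⁻¹' B) + δ₂) ∂μ₁ :=
          lintegral_mono fun x => h₂ _ (measurable_prodMk_left hB)
      _ = _ := by rw [lintegral_add_right _ measurable_const]; simp
  have step₁ : (μ₁.prod ν₂) B ≤ (ν₁.prod ν₂) B + δ₁ := by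
    rw [Measure.prod_apply_symm hB, Measure.prod_apply_symm hB]
    calc _ ≤ ∫⁻ y, (ν₁ ((fun x => (x, y)) ⁻¹' B) + δ₁) ∂ν₂ :=
          lintegral_mono fun y => h₁ _ (measurable_prodMk_right hB)
      _ = _ := by rw [lintegral_add_right _ measurable_const]; simp
  calc _ ≤ (ν₁.prod ν₂) B + δ₁ + δ₂ := step₂.trans (by gcongr)
    _ = _ := by rw [add_assoc]

/-- The total variation distance of Bernoulli(`p`) and Poisson(`p`) is at most `p ^ 2`. -/
lemma map_toNat_apply_le_poissonMeasure {Ω : Type*} [MeasurableSpace Ω] {P : Measure Ω}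
    [IsProbabilityMeasure P] {X : Ω → Bool} (hX : Measurable X) {p : ℝ≥0}
    (hp : P.real {ω | X ω = true} = p) (A : Set ℕ) :
    (P.map fun ω => (X ω).toNat) A ≤ poissonMeasure p A + (p : ℝ≥0∞) ^ 2 := by
  have hm : Measurable fun ω => (X ω).toNat := (measurable_of_finite Bool.toNat).comp hX
  rw [Measure.map_apply hm MeasurableSet.of_discrete]
  have ht : MeasurableSet {ω | X ω = true} := hX (measurableSet_singleton true)
  have hp1 : (p : ℝ) ≤ 1 := hp ▸ measureReal_le_one
  have hp0 : (0 : ℝ) ≤ p := p.2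
  have hc : P.real {ω | X ω = true}ᶜ = 1 - p := by rw [probReal_compl_eq_one_sub ht, hp]
  have he : 1 - (p : ℝ) ≤ Real.exp (-p) := by linarith [Real.add_one_le_exp (-(p : ℝ))]
  have q0 : (poissonMeasure p).real {0} = Real.exp (-p) := by
    simp [poissonMeasure_real_singleton]
  have q1 : (poissonMeasure p).real {1} = Real.exp (-p) * p := by
    simp [poissonMeasure_real_singleton]
  suffices h : P.real ((fun ω => (X ω).toNat) ⁻¹' A) ≤ (poissonMeasure p).real A + (p : ℝ) ^ 2 by
    rw [← ofReal_measureReal, ← ofReal_measureReal (μ := poissonMeasure p), ENNReal.coe_nnreal_eq,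
      ← ENNReal.ofReal_pow hp0, ← ENNReal.ofReal_add measureReal_nonneg (by positivity)]
    exact ENNReal.ofReal_le_ofReal h
  by_cases h0 : 0 ∈ A <;> by_cases h1 : 1 ∈ A
  · have hsub : ({0, 1} : Set ℕ) ⊆ A := by simp [Set.insert_subset_iff, h0, h1]
    have h01 : (poissonMeasure p).real {0, 1} = Real.exp (-p) + Real.exp (-p) * p := by
      rw [Set.insert_eq, measureReal_union (by simp) MeasurableSet.of_discrete, q0, q1]
    have := measureReal_mono (μ := poissonMeasure p) hsub
    have hle := measureReal_le_one (μ := P) (s := (fun ω => (X ω).toNat) ⁻¹' A)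
    nlinarith
  · have hA : (fun ω => (X ω).toNat) ⁻¹' A = {ω | X ω = true}ᶜ := by
      ext ω; cases h : X ω <;> simp [h, h0, h1]
    have := measureReal_mono (μ := poissonMeasure p) (Set.singleton_subset_iff.2 h0)
    rw [hA, hc]
    nlinarith
  · have hA : (fun ω => (X ω).toNat) ⁻¹' A = {ω | X ω = true} := by
      ext ω; cases h : X ω <;> simp [h, h0, h1]
    have := measureReal_mono (μ := poissonMeasure p) (Set.singleton_subset_iff.2 h1)
    rw [hA, hp]
    nlinarith
  · have hA : (fun ω => (X ω).toNat) ⁻¹' A = ∅ := by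
      ext ω; cases h : X ω <;> simp [h, h0, h1]
    rw [hA, measureReal_empty]
    positivity

lemma poissonMeasure_zero : poissonMeasure 0 = Measure.dirac 0 := by
  refine Measure.ext_of_singleton fun k => ?_
  rw [poissonMeasure_singleton]
  cases k <;> simp

/-- **Le Cam's inequality.** -/
theorem map_sum_toNat_apply_le_poissonMeasure {Ω ι : Type*} [MeasurableSpace Ω] {P : Measure Ω}
    [IsProbabilityMeasure P] {X : ι → Ω → Bool} (hX : ∀ i, Measurable (X i)) (hind : iIndepFun X P)
    {p : ι → ℝ≥0} (s : Finset ι) (hp : ∀ i ∈ s, P.real {ω | X i ω = true} = p i) (A : Set ℕ) :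
    (P.map (∑ i ∈ s, fun ω => (X i ω).toNat)) A ≤
      poissonMeasure (∑ i ∈ s, p i) A + ∑ i ∈ s, (p i : ℝ≥0∞) ^ 2 := by
  classical
  have hm : ∀ i, Measurable fun ω => (X i ω).toNat :=
    fun i => (measurable_of_finite Bool.toNat).comp (hX i)
  have hind' : iIndepFun (fun i ω => (X i ω).toNat) P :=
    hind.comp (fun _ => Bool.toNat) fun _ => measurable_of_finite _
  induction s using Finset.induction_on generalizing A with
  | empty =>
    simp only [Finset.sum_empty, poissonMeasure_zero, add_zero]
    rw [show (0 : Ω → ℕ) = fun _ => 0 from rfl, Measure.map_const]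
    simp
  | insert i s hi ih =>
    have hms : Measurable (∑ j ∈ s, fun ω => (X j ω).toNat) := by
      rw [Finset.sum_fn]; exact Finset.measurable_sum s fun j _ => hm j
    have := Measure.isProbabilityMeasure_map (μ := P) hms.aemeasurable
    have := Measure.isProbabilityMeasure_map (μ := P) (hm i).aemeasurable
    rw [Finset.sum_insert hi, Finset.sum_insert hi, Finset.sum_insert hi,
      IndepFun.map_add_eq_map_conv_map (hm i) hms (hind'.indepFun_finsetSum_of_notMem hm hi).symm,
      ← poissonMeasure_conv_poissonMeasure, Measure.conv, Measure.conv,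
      Measure.map_apply Measurable.of_discrete MeasurableSet.of_discrete,
      Measure.map_apply Measurable.of_discrete MeasurableSet.of_discrete]
    exact prod_apply_le_add
      (fun B _ => map_toNat_apply_le_poissonMeasure (hX i) (hp i (Finset.mem_insert_self i s)) B)
      (fun B _ => ih (fun j hj => hp j (Finset.mem_insert_of_mem hj)) B) MeasurableSet.of_discrete

/-- The difference of the numbers of successes in two disjoint collections of independent trials
is close to a Skellam variable in total variation. -/
lemma map_sub_apply_le_skellam {Ω ι : Type*} [MeasurableSpace Ω] {P : Measure Ω}
    [IsProbabilityMeasure P] {X : ι → Ω → Bool} (hX : ∀ i, Measurable (X i)) (hind : iIndepFun X P)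
    {p : ι → ℝ≥0} {s t : Finset ι} (hst : Disjoint s t)
    (hp : ∀ i, P.real {ω | X i ω = true} = p i)
    (hs : 0 < ∑ i ∈ s, p i) (ht : 0 < ∑ i ∈ t, p i) (A : Set ℤ) :
    (P.map fun ω => ((∑ i ∈ s, (X i ω).toNat : ℕ) : ℤ) - (∑ i ∈ t, (X i ω).toNat : ℕ)) A ≤
      skellam ((∑ i ∈ s, p i : ℝ≥0) : ℝ) ((∑ i ∈ t, p i : ℝ≥0) : ℝ) A +
        (∑ i ∈ s, (p i : ℝ≥0∞) ^ 2 + ∑ i ∈ t, (p i : ℝ≥0∞) ^ 2) := by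
  have hm : ∀ u : Finset ι, Measurable (∑ i ∈ u, fun ω => (X i ω).toNat) := fun u => by
    rw [Finset.sum_fn]
    exact Finset.measurable_sum u fun i _ => (measurable_of_finite Bool.toNat).comp (hX i)
  have hpr := fun u : Finset ι => Measure.isProbabilityMeasure_map (μ := P) (hm u).aemeasurable
  have hi : IndepFun (∑ i ∈ s, fun ω => (X i ω).toNat) (∑ i ∈ t, fun ω => (X i ω).toNat) P := by
    have h := (hind.indepFun_finset s t hst hX).comp
      (measurable_of_finite fun f : s → Bool => ∑ i, (f i).toNat)
      (measurable_of_finite fun f : t → Bool => ∑ i, (f i).toNat)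
    convert h using 1 <;> ext ω <;> simp only [Finset.sum_apply, Function.comp_apply]
    · exact (Finset.sum_coe_sort s fun i => (X i ω).toNat).symm
    · exact (Finset.sum_coe_sort t fun i => (X i ω).toNat).symm
  have hcomp : (fun ω => ((∑ i ∈ s, (X i ω).toNat : ℕ) : ℤ) - (∑ i ∈ t, (X i ω).toNat : ℕ)) =
      (fun q : ℕ × ℕ => (q.1 : ℤ) - q.2) ∘ fun ω =>
        ((∑ i ∈ s, fun ω => (X i ω).toNat) ω, (∑ i ∈ t, fun ω => (X i ω).toNat) ω) := by
    ext ω; simp only [Function.comp_apply, Finset.sum_apply]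
  rw [hcomp, ← Measure.map_map Measurable.of_discrete ((hm s).prodMk (hm t)),
    (indepFun_iff_map_prod_eq_prod_map_map (hm s).aemeasurable (hm t).aemeasurable).1 hi,
    skellam_eq_map_poisson hs ht,
    Measure.map_apply Measurable.of_discrete MeasurableSet.of_discrete,
    Measure.map_apply Measurable.of_discrete MeasurableSet.of_discrete]
  exact prod_apply_le_add
    (fun B _ => map_sum_toNat_apply_le_poissonMeasure hX hind s (fun i _ => hp i) B)
    (fun B _ => map_sum_toNat_apply_le_poissonMeasure hX hind t (fun i _ => hp i) B)
    MeasurableSet.of_discrete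

/-- A one-sided bound in total variation bounds the Kolmogorov-Smirnov distance. -/
lemma ksDist_le_of_apply_le {μ ν : Measure ℝ} [IsProbabilityMeasure μ] [IsProbabilityMeasure ν]
    {δ : ℝ} (hδ : 0 ≤ δ) (h : ∀ A, MeasurableSet A → μ A ≤ ν A + ENNReal.ofReal δ) :
    ksDist μ ν ≤ δ := by
  have h' : ∀ A, MeasurableSet A → μ.real A ≤ ν.real A + δ := fun A hA => by
    have := ENNReal.toReal_mono (by finiteness) (h A hA)
    rwa [ENNReal.toReal_add (by finiteness) (by finiteness), ENNReal.toReal_ofReal hδ] at this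
  refine ciSup_le fun x => abs_le.2 ⟨?_, ?_⟩
  · have := h' _ (measurableSet_Iic (a := x)).compl
    rw [probReal_compl_eq_one_sub measurableSet_Iic, probReal_compl_eq_one_sub measurableSet_Iic]
      at this
    linarith
  · linarith [h' _ (measurableSet_Iic (a := x))]

/-- The distance to a law without atoms is at least half the mass of any atom. -/
lemma measureReal_singleton_le_two_mul_ksDist (μ ν : Measure ℝ) [IsProbabilityMeasure μ]
    [IsProbabilityMeasure ν] [NullSingletonClass ν] (x : ℝ) : μ.real {x} ≤ 2 * ksDist μ ν := by
  have hle : ∀ y, |μ.real (Set.Iic y) - ν.real (Set.Iic y)| ≤ ksDist μ ν :=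
    fun y => le_ciSup (bddAbove_ksDist μ ν) y
  have hpos : ∀ k : ℕ, x - 1 / ((k : ℝ) + 1) < x := fun k => sub_lt_self _ (by positivity)
  have hlim : Tendsto (fun k : ℕ => ν.real (Set.Ioc (x - 1 / ((k : ℝ) + 1)) x)) atTop (𝓝 0) := by
    have hinter : ⋂ k : ℕ, Set.Ioc (x - 1 / ((k : ℝ) + 1)) x = {x} := by
      ext y
      simp only [Set.mem_iInter, Set.mem_Ioc, Set.mem_singleton_iff]
      refine ⟨fun h => le_antisymm (h 0).2 ?_, by rintro rfl k; exact ⟨hpos k, le_rfl⟩⟩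
      have := (tendsto_one_div_add_atTop_nhds_zero_nat (𝕜 := ℝ)).const_sub x
      rw [sub_zero] at this
      exact le_of_tendsto' this fun k => (h k).1.le
    have h := tendsto_measure_iInter_atTop (μ := ν)
      (s := fun k : ℕ => Set.Ioc (x - 1 / ((k : ℝ) + 1)) x)
      (fun k => measurableSet_Ioc.nullMeasurableSet)
      (fun a b hab => Set.Ioc_subset_Ioc_left
        (sub_le_sub_left (Nat.one_div_le_one_div (α := ℝ) hab) x)) ⟨0, measure_ne_top _ _⟩
    rw [hinter, measure_singleton] at h
    exact (ENNReal.tendsto_toReal ENNReal.zero_ne_top).comp h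
  have hbound : ∀ k : ℕ,
      μ.real {x} ≤ 2 * ksDist μ ν + ν.real (Set.Ioc (x - 1 / ((k : ℝ) + 1)) x) := fun k => by
    have hd : ∀ ρ : Measure ℝ, IsProbabilityMeasure ρ →
        ρ.real (Set.Ioc (x - 1 / ((k : ℝ) + 1)) x) =
          ρ.real (Set.Iic x) - ρ.real (Set.Iic (x - 1 / ((k : ℝ) + 1))) := fun ρ _ => by
      rw [← Set.Iic_sdiff_Iic, measureReal_sdiff (Set.Iic_subset_Iic.2 (hpos k).le) measurableSet_Iic]
    have h1 : μ.real {x} ≤ μ.real (Set.Ioc (x - 1 / ((k : ℝ) + 1)) x) :=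
      measureReal_mono (Set.singleton_subset_iff.2 ⟨hpos k, le_rfl⟩)
    have h2 := abs_le.1 (hle x)
    have h3 := abs_le.1 (hle (x - 1 / ((k : ℝ) + 1)))
    rw [hd μ inferInstance] at h1
    rw [hd ν inferInstance]
    linarith
  simpa using le_of_tendsto_of_tendsto' tendsto_const_nhds (hlim.const_add (2 * ksDist μ ν)) hbound

section Graph

variable {V Ω : Type*} (G : SimpleGraph V) (Y : VertexPair V → Ω → Bool)

open Classical in
/-- Whether the decision at the vertex pair `e` is wrong. -/
noncomputable def isError (e : VertexPair V) (ω : Ω) : Bool :=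
  Bool.xor (decide ((e : Sym2 V) ∈ G.edgeSet)) (Y e ω)

lemma isError_of_mem {e : VertexPair V} (h : (e : Sym2 V) ∈ G.edgeSet) (ω : Ω) :
    isError G Y e ω = !Y e ω := by simp [isError, h]

lemma isError_of_notMem {e : VertexPair V} (h : (e : Sym2 V) ∉ G.edgeSet) (ω : Ω) :
    isError G Y e ω = Y e ω := by simp [isError, h]

section

variable {G Y} [MeasurableSpace Ω] {P : Measure Ω} {α β : ℝ}

namespace IsIndepHomogeneousNoise

lemma measurable_isError (h : IsIndepHomogeneousNoise P G Y α β) (e : VertexPair V) :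
    Measurable (isError G Y e) := by
  classical
  exact (measurable_of_finite (Bool.xor (decide ((e : Sym2 V) ∈ G.edgeSet)))).comp (h.measurable e)

lemma iIndepFun_isError (h : IsIndepHomogeneousNoise P G Y α β) : iIndepFun (isError G Y) P := by
  classical
  exact h.indep.comp (fun e => Bool.xor (decide ((e : Sym2 V) ∈ G.edgeSet)))
    fun _ => measurable_of_finite _

lemma measurable_sum_isError_sub (h : IsIndepHomogeneousNoise P G Y α β)
    (s t : Finset (VertexPair V)) :
    Measurable fun ω => ((∑ e ∈ s, (isError G Y e ω).toNat : ℕ) : ℤ) -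
      (∑ e ∈ t, (isError G Y e ω).toNat : ℕ) := by
  have hm : ∀ s : Finset (VertexPair V), Measurable fun ω => ∑ e ∈ s, (isError G Y e ω).toNat :=
    fun s => Finset.measurable_sum s fun e _ =>
      (measurable_of_finite Bool.toNat).comp (h.measurable_isError e)
  exact (Measurable.of_discrete (f := fun q : ℕ × ℕ => (q.1 : ℤ) - q.2)).comp ((hm s).prodMk (hm t))

open Classical in
lemma prob_isError [IsProbabilityMeasure P] (h : IsIndepHomogeneousNoise P G Y α β)
    (e : VertexPair V) :
    P.real {ω | isError G Y e ω = true} = if (e : Sym2 V) ∈ G.edgeSet then β else α := by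
  split_ifs with he
  · have : {ω | isError G Y e ω = true} = {ω | Y e ω = true}ᶜ := by
      ext ω; simp [isError_of_mem G Y he]
    rw [this, probReal_compl_eq_one_sub
        (measurableSet_eq_fun (h.measurable e) measurable_const),
      h.prob_edge e he]
    ring
  · simp_rw [isError_of_notMem G Y he]
    exact h.prob_nonEdge e he

end IsIndepHomogeneousNoise

end

variable [Fintype V]

open Classical in
/-- The vertex pairs that are edges of `G`, as a finset. -/
noncomputable def edgePairs : Finset (VertexPair V) := {e | (e : Sym2 V) ∈ G.edgeSet}

open Classical in
/-- The vertex pairs that are not edges of `G`, as a finset. -/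
noncomputable def nonEdgePairs : Finset (VertexPair V) := {e | (e : Sym2 V) ∉ G.edgeSet}

lemma mem_edgePairs {e : VertexPair V} : e ∈ edgePairs G ↔ (e : Sym2 V) ∈ G.edgeSet := by
  simp [edgePairs]

lemma mem_nonEdgePairs {e : VertexPair V} : e ∈ nonEdgePairs G ↔ (e : Sym2 V) ∉ G.edgeSet := by
  simp [nonEdgePairs]

lemma disjoint_nonEdgePairs_edgePairs : Disjoint (nonEdgePairs G) (edgePairs G) :=
  Finset.disjoint_left.2 fun _ h h' => (mem_nonEdgePairs G).1 h ((mem_edgePairs G).1 h')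

@[to_additive]
lemma prod_nonEdgePairs_mul_prod_edgePairs {M : Type*} [CommMonoid M] [Fintype (VertexPair V)]
    (f : VertexPair V → M) :
    (∏ e ∈ nonEdgePairs G, f e) * ∏ e ∈ edgePairs G, f e = ∏ e, f e := by
  classical
  rw [mul_comm, ← Finset.prod_filter_mul_prod_filter_not Finset.univ
    fun e : VertexPair V => (e : Sym2 V) ∈ G.edgeSet]
  congr 2 <;> ext e <;> simp [mem_nonEdgePairs, mem_edgePairs]

lemma card_edgePairs : (edgePairs G).card = numEdges G := by
  have h : G.edgeSet = Subtype.val '' (edgePairs G : Set (VertexPair V)) := by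
    ext e
    simp only [Set.mem_image, Finset.mem_coe, mem_edgePairs, Subtype.exists, exists_and_right,
      exists_eq_right, exists_prop]
    exact ⟨fun he => ⟨G.not_isDiag_of_mem_edgeSet he, he⟩, fun h => h.2⟩
  rw [numEdges, h, Set.ncard_image_of_injective _ Subtype.val_injective, Set.ncard_coe_finset]

lemma card_nonEdgePairs : (nonEdgePairs G).card = numNonEdges G := by
  rw [numNonEdges, ← Set.ncard_coe_finset]
  congr 1
  ext e
  simp [mem_nonEdgePairs]

lemma numNonEdges_add_numEdges : numNonEdges G + numEdges G = (Fintype.card V).choose 2 := by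
  classical
  rw [← card_nonEdgePairs, ← card_edgePairs, ← Sym2.card_subtype_not_diag, Finset.card_eq_sum_ones,
    Finset.card_eq_sum_ones, sum_nonEdgePairs_add_sum_edgePairs]
  simp

/-- The discrepancy is the number of false positives minus the number of false negatives. -/
lemma edgeDiscrepancy_eq (ω : Ω) :
    edgeDiscrepancy G Y ω =
      ((((∑ e ∈ nonEdgePairs G, (isError G Y e ω).toNat : ℕ) : ℤ) -
        (∑ e ∈ edgePairs G, (isError G Y e ω).toNat : ℕ) : ℤ) : ℝ) := by
  classical
  have h1 : (inferredEdges Y ω).ncard = ∑ e ∈ nonEdgePairs G, (isError G Y e ω).toNat +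
      ∑ e ∈ edgePairs G, (Y e ω).toNat := by
    have : inferredEdges Y ω = ((Finset.univ.filter fun e => Y e ω = true : Finset _) : Set _) := by
      ext e; simp [inferredEdges]
    rw [this, Set.ncard_coe_finset, Finset.card_filter, ← sum_nonEdgePairs_add_sum_edgePairs G]
    refine congr_arg₂ _ (Finset.sum_congr rfl fun e he => ?_) (Finset.sum_congr rfl fun e _ => ?_)
    · rw [isError_of_notMem G Y ((mem_nonEdgePairs G).1 he)]
      cases Y e ω <;> rfl
    · cases Y e ω <;> rfl
  have h2 : ∑ e ∈ edgePairs G, (Y e ω).toNat + ∑ e ∈ edgePairs G, (isError G Y e ω).toNat =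
      numEdges G := by
    rw [← card_edgePairs, ← Finset.sum_add_distrib, Finset.card_eq_sum_ones]
    refine Finset.sum_congr rfl fun e he => ?_
    rw [isError_of_mem G Y ((mem_edgePairs G).1 he)]
    cases Y e ω <;> rfl
  rw [edgeDiscrepancy, h1, ← h2]
  push_cast
  ring

variable {G Y} [MeasurableSpace Ω] {P : Measure Ω} {α β lam : ℝ}

namespace IsIndepHomogeneousNoise

lemma measurable_edgeDiscrepancy (h : IsIndepHomogeneousNoise P G Y α β) :
    Measurable (edgeDiscrepancy G Y) := by
  rw [funext (edgeDiscrepancy_eq G Y)]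
  exact (Measurable.of_discrete (f := fun k : ℤ => (k : ℝ))).comp
    (h.measurable_sum_isError_sub _ _)

variable [IsProbabilityMeasure P]

/-- The Skellam approximation of the discrepancy has error at most `lam * (α + β)`. -/
lemma ksSkellam_le (h : IsIndepHomogeneousNoise P G Y α β) (hα : 0 ≤ α) (hβ : 0 ≤ β)
    (hlam : 0 < lam) (hlα : (numNonEdges G : ℝ) * α = lam) (hlβ : (numEdges G : ℝ) * β = lam) :
    ksSkellam P G Y lam ≤ lam * (α + β) := by
  classical
  lift α to ℝ≥0 using hα
  lift β to ℝ≥0 using hβ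
  lift lam to ℝ≥0 using hlam.le
  let p : VertexPair V → ℝ≥0 := fun e => if (e : Sym2 V) ∈ G.edgeSet then β else α
  have hpn : ∀ e ∈ nonEdgePairs G, p e = α := fun e he => if_neg ((mem_nonEdgePairs G).1 he)
  have hpe : ∀ e ∈ edgePairs G, p e = β := fun e he => if_pos ((mem_edgePairs G).1 he)
  have hsn : ∑ e ∈ nonEdgePairs G, p e = lam := by
    rw [Finset.sum_congr rfl hpn, Finset.sum_const, card_nonEdgePairs, nsmul_eq_mul]
    exact_mod_cast hlα
  have hse : ∑ e ∈ edgePairs G, p e = lam := by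
    rw [Finset.sum_congr rfl hpe, Finset.sum_const, card_edgePairs, nsmul_eq_mul]
    exact_mod_cast hlβ
  have hqn : ∑ e ∈ nonEdgePairs G, (p e : ℝ≥0∞) ^ 2 = (lam * α : ℝ≥0) := by
    rw [Finset.sum_congr rfl fun e he => by rw [hpn e he], Finset.sum_const, card_nonEdgePairs,
      ← hsn, Finset.sum_congr rfl hpn, Finset.sum_const, card_nonEdgePairs]
    push_cast [nsmul_eq_mul]
    ring
  have hqe : ∑ e ∈ edgePairs G, (p e : ℝ≥0∞) ^ 2 = (lam * β : ℝ≥0) := by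
    rw [Finset.sum_congr rfl fun e he => by rw [hpe e he], Finset.sum_const, card_edgePairs,
      ← hse, Finset.sum_congr rfl hpe, Finset.sum_const, card_edgePairs]
    push_cast [nsmul_eq_mul]
    ring
  have hl : 0 < lam := by exact_mod_cast hlam
  have key := map_sub_apply_le_skellam (s := nonEdgePairs G) (t := edgePairs G) (p := p)
    h.measurable_isError h.iIndepFun_isError (disjoint_nonEdgePairs_edgePairs G)
    (fun e => by rw [h.prob_isError e]; simp only [p]; split_ifs <;> rfl)
    (by rwa [hsn]) (by rwa [hse])
  rw [hsn, hse, hqn, hqe] at key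
  have : IsProbabilityMeasure (P.map (edgeDiscrepancy G Y)) :=
    Measure.isProbabilityMeasure_map h.measurable_edgeDiscrepancy.aemeasurable
  have : IsProbabilityMeasure (skellamReal lam lam) := by
    have : IsProbabilityMeasure (skellam lam lam) := by
      rw [skellam_eq_map_poisson hl hl]
      exact Measure.isProbabilityMeasure_map Measurable.of_discrete.aemeasurable
    exact Measure.isProbabilityMeasure_map Measurable.of_discrete.aemeasurable
  refine ksDist_le_of_apply_le (by positivity) fun A hA => ?_
  have hk := key ((fun k : ℤ => (k : ℝ)) ⁻¹' A)
  rw [Measure.map_apply (h.measurable_sum_isError_sub _ _) MeasurableSet.of_discrete] at hk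
  rw [Measure.map_apply h.measurable_edgeDiscrepancy hA, skellamReal,
    Measure.map_apply Measurable.of_discrete hA]
  have hδ : ENNReal.ofReal ((lam : ℝ) * (α + β)) = ((lam * α : ℝ≥0) : ℝ≥0∞) + (lam * β : ℝ≥0) := by
    rw [← ENNReal.coe_add, ← mul_add, ← ENNReal.ofReal_coe_nnreal]
    push_cast
    rfl
  rw [hδ]
  convert hk using 2
  ext ω
  simp [edgeDiscrepancy_eq G Y ω]

/-- The discrepancy vanishes if there are no errors. -/
lemma le_prob_edgeDiscrepancy_eq_zero (h : IsIndepHomogeneousNoise P G Y α β) :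
    (1 - α) ^ numNonEdges G * (1 - β) ^ numEdges G ≤
      P.real {ω | edgeDiscrepancy G Y ω = 0} := by
  classical
  have hsub : ⋂ e ∈ (Finset.univ : Finset (VertexPair V)), isError G Y e ⁻¹' {false} ⊆
      {ω | edgeDiscrepancy G Y ω = 0} := by
    intro ω hω
    simp only [Finset.mem_univ, Set.iInter_true, Set.mem_iInter, Set.mem_preimage,
      Set.mem_singleton_iff] at hω
    simp [edgeDiscrepancy_eq, hω]
  refine le_trans (le_of_eq ?_) (measureReal_mono hsub)
  rw [Measure.real, h.iIndepFun_isError.measure_inter_preimage_eq_mul Finset.univ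
    (sets := fun _ => {false}) (fun _ _ => measurableSet_singleton _), ENNReal.toReal_prod,
    ← prod_nonEdgePairs_mul_prod_edgePairs G, ← card_nonEdgePairs, ← card_edgePairs,
    ← Finset.prod_const, ← Finset.prod_const]
  have hcompl : ∀ e, P.real (isError G Y e ⁻¹' {false}) =
      1 - if (e : Sym2 V) ∈ G.edgeSet then β else α := fun e => by
    have : isError G Y e ⁻¹' {false} = {ω | isError G Y e ω = true}ᶜ := by ext ω; simp
    rw [this, probReal_compl_eq_one_sub
        (measurableSet_eq_fun (h.measurable_isError e) measurable_const),
      h.prob_isError]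
  refine congr_arg₂ _ (Finset.prod_congr rfl fun e he => ?_) (Finset.prod_congr rfl fun e he => ?_)
  · exact ((hcompl e).trans (by rw [if_neg ((mem_nonEdgePairs G).1 he)])).symm
  · exact ((hcompl e).trans (by rw [if_pos ((mem_edgePairs G).1 he)])).symm

/-- The normal approximation of the discrepancy cannot see the atom at `0`. -/
lemma prob_edgeDiscrepancy_eq_zero_le (h : IsIndepHomogeneousNoise P G Y α β) :
    P.real {ω | edgeDiscrepancy G Y ω = 0} ≤ 2 * ksNormal P G Y := by
  have hm : Measurable fun ω => edgeDiscrepancy G Y ω / √(Var[edgeDiscrepancy G Y; P]) :=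
    h.measurable_edgeDiscrepancy.div_const _
  have : IsProbabilityMeasure
      (P.map fun ω => edgeDiscrepancy G Y ω / √(Var[edgeDiscrepancy G Y; P])) :=
    Measure.isProbabilityMeasure_map hm.aemeasurable
  have : NullSingletonClass (gaussianReal 0 1) := nullSingletonClass_gaussianReal one_ne_zero
  refine le_trans ?_ (measureReal_singleton_le_two_mul_ksDist _ _ 0)
  rw [map_measureReal_apply hm (measurableSet_singleton 0)]
  exact measureReal_mono fun ω (hω : _ = 0) => by simp [hω]

end IsIndepHomogeneousNoise

end Graph

lemma exp_neg_two_mul_le_one_sub {x : ℝ} (h0 : 0 ≤ x) (h1 : x ≤ 1 / 2) :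
    Real.exp (-(2 * x)) ≤ 1 - x := by
  rw [Real.exp_neg]
  refine inv_le_of_inv_le₀ (by linarith) (le_trans ?_ (Real.add_one_le_exp (2 * x)))
  rw [inv_le_iff_one_le_mul₀ (by linarith)]
  nlinarith

lemma tendsto_mul_log_atTop : Tendsto (fun x : ℝ => x * Real.log x) atTop atTop :=
  tendsto_id.atTop_mul_atTop₀ Real.tendsto_log_atTop

/-- A graph with `O(n log n)` edges has at least `n log n` non-edges if it is large. -/
lemma eventually_mul_log_le_numNonEdges (b : ℝ) :
    ∀ᶠ x : ℝ in atTop, ∀ (V : Type*) [Fintype V] (G : SimpleGraph V), (Fintype.card V : ℝ) = x →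
      (numEdges G : ℝ) ≤ b * (x * Real.log x) → x * Real.log x ≤ numNonEdges G := by
  have hc : 0 < 1 / (4 * (|b| + 1)) := by positivity
  filter_upwards [Real.isLittleO_log_id_atTop.bound hc, eventually_ge_atTop 2]
    with x hx hx2 V _ G hV hb
  have hlog : 0 ≤ Real.log x := Real.log_nonneg (by linarith)
  have hx0 : 0 ≤ x := by linarith
  rw [Real.norm_of_nonneg hlog, id, Real.norm_of_nonneg hx0, one_div_mul_eq_div,
    le_div_iff₀ (by positivity)] at hx
  have hsum : (numNonEdges G : ℝ) + numEdges G = x * (x - 1) / 2 := by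
    rw [← hV, ← Nat.cast_choose_two, ← numNonEdges_add_numEdges G, Nat.cast_add]
  have h1 : b * (x * Real.log x) ≤ |b| * (x * Real.log x) :=
    mul_le_mul_of_nonneg_right (le_abs_self b) (by positivity)
  nlinarith

end EdgeNoise

theorem mainTheorem2 {ι : Type*} {l : Filter ι}
    {V : ι → Type*} [∀ i, Fintype (V i)] (G : ∀ i, SimpleGraph (V i))
    {Ω : ι → Type*} [∀ i, MeasurableSpace (Ω i)]
    (P : ∀ i, Measure (Ω i)) [∀ i, IsProbabilityMeasure (P i)]
    (Y : ∀ i, EdgeNoise.VertexPair (V i) → Ω i → Bool)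
    (α β lam n : ι → ℝ)
    (hn : ∀ i, n i = (Fintype.card (V i) : ℝ))
    -- large graphs
    (hlarge : Tendsto n l atTop)
    -- sparse graphs
    (hsparse : (fun i => (EdgeNoise.numEdges (G i) : ℝ)) =Θ[l] fun i => n i * Real.log (n i))
    -- unbiasedness; `lam` is the common value of the expected numbers of errors of the two types
    (hunbiased : ∀ i, (EdgeNoise.numNonEdges (G i) : ℝ) * α i = lam i ∧
      (EdgeNoise.numEdges (G i) : ℝ) * β i = lam i)
    -- constant error rate
    (hrate : lam =Θ[l] fun _ => (1 : ℝ))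
    -- homogeneous and independent errors
    (hαβ : ∀ i, α i ∈ Set.Ioo (0 : ℝ) 1 ∧ β i ∈ Set.Ioo (0 : ℝ) 1)
    (hnoise : ∀ i, EdgeNoise.IsIndepHomogeneousNoise (P i) (G i) (Y i) (α i) (β i)) :
    ((fun i => EdgeNoise.ksSkellam (P i) (G i) (Y i) (lam i)) =O[l]
        fun i => (n i * Real.log (n i))⁻¹) ∧
      ((fun i => (n i * Real.log (n i))⁻¹) =O[l]
        fun i => EdgeNoise.ksNormal (P i) (G i) (Y i)) ∧
      ∀ᶠ i in l, EdgeNoise.ksSkellam (P i) (G i) (Y i) (lam i) ≤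
        EdgeNoise.ksNormal (P i) (G i) (Y i) := by
  have hr : Tendsto (fun i => n i * Real.log (n i)) l atTop :=
    EdgeNoise.tendsto_mul_log_atTop.comp hlarge
  obtain ⟨b, hb⟩ := hsparse.1.bound
  obtain ⟨a, ha, hab⟩ := hsparse.2.exists_pos
  obtain ⟨C, hC⟩ := hrate.1.bound
  obtain ⟨c, hc, hcb⟩ := hrate.2.exists_pos
  have hC0 : ∀ᶠ i in l, lam i ≤ C := hC.mono fun i hi => by
    simpa using (le_abs_self _).trans hi
  have hlam0 : ∀ᶠ i in l, 0 < lam i := hcb.bound.mono fun i hi => by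
    have h0 : 0 ≤ lam i := by
      rw [← (hunbiased i).2]
      exact mul_nonneg (Nat.cast_nonneg _) (hαβ i).2.1.le
    rw [norm_one, Real.norm_of_nonneg h0] at hi
    by_contra hle
    nlinarith
  have hnon : ∀ᶠ i in l, n i * Real.log (n i) ≤ EdgeNoise.numNonEdges (G i) := by
    filter_upwards [hlarge.eventually (EdgeNoise.eventually_mul_log_le_numNonEdges b), hb,
      hr.eventually_ge_atTop 0] with i hi hbi hri
    refine hi (V i) (G i) (hn i).symm ?_
    rwa [Real.norm_natCast, Real.norm_of_nonneg hri] at hbi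
  have hedge : ∀ᶠ i in l, n i * Real.log (n i) ≤ a * EdgeNoise.numEdges (G i) := by
    filter_upwards [hab.bound, hr.eventually_ge_atTop 0] with i hi hri
    rwa [Real.norm_natCast, Real.norm_of_nonneg hri] at hi
  have hα : ∀ᶠ i in l, α i ≤ C * (n i * Real.log (n i))⁻¹ := by
    filter_upwards [hnon, hC0, hr.eventually_gt_atTop 0] with i hi hCi hri
    rw [← div_eq_mul_inv, le_div_iff₀ hri]
    calc _ ≤ α i * EdgeNoise.numNonEdges (G i) := mul_le_mul_of_nonneg_left hi (hαβ i).1.1.le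
      _ ≤ C := by rw [mul_comm, (hunbiased i).1]; exact hCi
  have hβ : ∀ᶠ i in l, β i ≤ a * C * (n i * Real.log (n i))⁻¹ := by
    filter_upwards [hedge, hC0, hr.eventually_gt_atTop 0] with i hi hCi hri
    rw [← div_eq_mul_inv, le_div_iff₀ hri]
    calc _ ≤ β i * (a * EdgeNoise.numEdges (G i)) := mul_le_mul_of_nonneg_left hi (hαβ i).2.1.le
      _ = a * (EdgeNoise.numEdges (G i) * β i) := by ring
      _ ≤ a * C := by rw [(hunbiased i).2]; gcongr
  have hinv : Tendsto (fun i => (n i * Real.log (n i))⁻¹) l (𝓝 0) := hr.inv_tendsto_atTop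
  have hsmall : ∀ K : ℝ, ∀ ε > 0, ∀ᶠ i in l, K * (n i * Real.log (n i))⁻¹ ≤ ε := fun K ε hε => by
    have := hinv.const_mul K
    rw [mul_zero] at this
    exact this.eventually_le_const hε
  -- the Skellam approximation
  have hskellam : ∀ᶠ i in l, EdgeNoise.ksSkellam (P i) (G i) (Y i) (lam i) ≤
      C * (C + a * C) * (n i * Real.log (n i))⁻¹ := by
    filter_upwards [hα, hβ, hC0, hlam0] with i hαi hβi hCi hli
    refine ((hnoise i).ksSkellam_le (hαβ i).1.1.le (hαβ i).2.1.le hli (hunbiased i).1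
      (hunbiased i).2).trans ?_
    calc lam i * (α i + β i) ≤ C * (C * (n i * Real.log (n i))⁻¹ +
          a * C * (n i * Real.log (n i))⁻¹) :=
        mul_le_mul hCi (add_le_add hαi hβi) (add_nonneg (hαβ i).1.1.le (hαβ i).2.1.le)
          (hli.le.trans hCi)
      _ = _ := by ring
  -- the normal approximation
  have hκ : 0 < Real.exp (-(4 * C)) / 2 := by positivity
  have hnormal : ∀ᶠ i in l, Real.exp (-(4 * C)) / 2 ≤ EdgeNoise.ksNormal (P i) (G i) (Y i) := by
    filter_upwards [hα, hβ, hC0, hsmall C (1 / 2) (by norm_num),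
      hsmall (a * C) (1 / 2) (by norm_num)] with i hαi hβi hCi h1 h2
    have hexp : Real.exp (-(4 * C)) ≤ (1 - α i) ^ EdgeNoise.numNonEdges (G i) *
        (1 - β i) ^ EdgeNoise.numEdges (G i) :=
      calc Real.exp (-(4 * C)) ≤ Real.exp (-(4 * lam i)) := Real.exp_le_exp.2 (by linarith)
        _ = Real.exp (-(2 * α i)) ^ EdgeNoise.numNonEdges (G i) *
            Real.exp (-(2 * β i)) ^ EdgeNoise.numEdges (G i) := by
          rw [← Real.exp_nat_mul, ← Real.exp_nat_mul, ← Real.exp_add]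
          congr 1
          linear_combination 2 * (hunbiased i).1 + 2 * (hunbiased i).2
        _ ≤ _ := by
          gcongr
          · exact pow_nonneg (sub_nonneg.2 (hαβ i).1.2.le) _
          · exact EdgeNoise.exp_neg_two_mul_le_one_sub (hαβ i).1.1.le (hαi.trans h1)
          · exact EdgeNoise.exp_neg_two_mul_le_one_sub (hαβ i).2.1.le (hβi.trans h2)
    linarith [(hnoise i).le_prob_edgeDiscrepancy_eq_zero,
      (hnoise i).prob_edgeDiscrepancy_eq_zero_le]
  refine ⟨IsBigO.of_bound (C * (C + a * C)) ?_, ?_, ?_⟩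
  · filter_upwards [hskellam, hr.eventually_ge_atTop 0] with i hi hri
    have h0 : 0 ≤ EdgeNoise.ksSkellam (P i) (G i) (Y i) (lam i) :=
      Real.iSup_nonneg fun x => abs_nonneg _
    rwa [Real.norm_of_nonneg (inv_nonneg.2 hri), Real.norm_of_nonneg h0]
  · refine IsBigO.of_bound 1 ?_
    filter_upwards [hnormal, hsmall 1 _ hκ, hr.eventually_ge_atTop 0] with i hi h1 hri
    rw [Real.norm_of_nonneg (inv_nonneg.2 hri), Real.norm_of_nonneg (hκ.le.trans hi), one_mul]
    rw [one_mul] at h1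
    exact h1.trans hi
  · filter_upwards [hskellam, hnormal, hsmall (C * (C + a * C)) _ hκ] with i h1 h2 h3
    exact h1.trans (h3.trans h2)
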